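/- Let $Sol$ be the group $\mathbb{R}^3$ with product $(z,x,y)(z',x',y')=(z+z',\,x+e^{-z}x',\,y+e^{z}y')$, and let $d$ be the distance of the left-invariant Riemannian metric $ds^2=dz^2+e^{2z}dx^2+e^{-2z}dy^2$. For a probability measure $\mu$ on $Sol$ let $W_0=\mathrm{id}$, $W_n=X_1\cdots X_n$ be the random walk with independent increments $X_j$ of law $\mu$, and write $W_n=(S_n,U_n,V_n)$. Let $\mu_z$, $\mu_x$ and $\pi_*\mu$ be the images of $\mu$ under the maps $(z,x,y)\mapsto z$, $(z,x,y)\mapsto x$ and $(z,x,y)\mapsto(z,x)$. When $U_n$ converges almost surely, the harmonic measure $\nu$ of $\mu$ is the distribution on $\mathbb{R}$ of $\xi=\lim_n U_n$. For every $k\in\mathbb{N}$ there exists $\gamma_k>0$ such that for Lebesgue-almost every $\gamma\in(0,\gamma_k)$ the following holds. Let $p\in(\tfrac12,1]$, and let $\mu$ be any probability measure on $Sol$ with finite first moment $\int d(\mathrm{id},g)\,d\mu(g)<\infty$ such that $\pi_*\mu=\mu_z\times\mu_x$, where $$\mu_z=p\,\delta_\gamma+(1-p)\,\delta_{-\gamma},\qquad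 \mu_x=\tfrac12\delta_1+\tfrac12\delta_{-1}.$$ Then $U_n$ converges almost surely, and the harmonic measure $\nu$ of $\mu$ has a density of class $C^k$ with respect to Lebesgue measure on $\mathbb{R}$. -/

import Mathlib

open MeasureTheory Filter Topology

/-- The group `Sol`, in the coordinates `(z, x, y)` of `ℝ³`. -/
@[ext]
structure Sol where
  z : ℝ
  x : ℝ
  y : ℝ

namespace Sol

noncomputable section

/-- The product `(z, x, y) (z', x', y') = (z + z', x + e^{-z} x', y + e^z y')`. -/
instance : Mul Sol :=
  ⟨fun g h => ⟨g.z + h.z, g.x + Real.exp (-g.z) * h.x, g.y + Real.exp g.z * h.y⟩⟩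

instance : One Sol := ⟨⟨0, 0, 0⟩⟩

instance : Inv Sol := ⟨fun g => ⟨-g.z, -(Real.exp g.z * g.x), -(Real.exp (-g.z) * g.y)⟩⟩

@[simp] theorem mul_z (g h : Sol) : (g * h).z = g.z + h.z := rfl
@[simp] theorem mul_x (g h : Sol) : (g * h).x = g.x + Real.exp (-g.z) * h.x := rfl
@[simp] theorem mul_y (g h : Sol) : (g * h).y = g.y + Real.exp g.z * h.y := rfl
@[simp] theorem one_z : (1 : Sol).z = 0 := rfl
@[simp] theorem one_x : (1 : Sol).x = 0 := rfl
@[simp] theorem one_y : (1 : Sol).y = 0 := rfl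
@[simp] theorem inv_z (g : Sol) : (g⁻¹).z = -g.z := rfl
@[simp] theorem inv_x (g : Sol) : (g⁻¹).x = -(Real.exp g.z * g.x) := rfl
@[simp] theorem inv_y (g : Sol) : (g⁻¹).y = -(Real.exp (-g.z) * g.y) := rfl

instance : Group Sol :=
  Group.ofLeftAxioms
    (fun a b c => by
      ext
      · simp [add_assoc]
      · simp only [mul_x, mul_z, neg_add, Real.exp_add]; ring
      · simp only [mul_y, mul_z, Real.exp_add]; ring)
    (fun a => by ext <;> simp)
    (fun a => by ext <;> simp)

/-- The Borel σ-algebra of `Sol ≃ ℝ³`. -/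
instance : MeasurableSpace Sol :=
  MeasurableSpace.comap (fun g : Sol => (g.z, g.x, g.y)) inferInstance

theorem measurable_coords : Measurable (fun g : Sol => (g.z, g.x, g.y)) :=
  comap_measurable _

theorem measurable_z : Measurable Sol.z := measurable_coords.fst
theorem measurable_x : Measurable Sol.x := measurable_coords.snd.fst
theorem measurable_y : Measurable Sol.y := measurable_coords.snd.snd

theorem measurable_of_coords {α : Type*} [MeasurableSpace α] {f : α → Sol}
    (hz : Measurable fun a => (f a).z) (hx : Measurable fun a => (f a).x)
    (hy : Measurable fun a => (f a).y) : Measurable f :=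
  measurable_comap_iff.2 (hz.prodMk (hx.prodMk hy))

/-- The length of the curve `t ↦ (z t, x t, y t)`, `0 ≤ t ≤ 1`, for the left-invariant
Riemannian metric `ds² = dz² + e^{2z} dx² + e^{-2z} dy²`. -/
def curveLength (c : ℝ → Sol) : ENNReal :=
  ∫⁻ t in Set.Icc (0 : ℝ) 1, ENNReal.ofReal (Real.sqrt
    (deriv (fun s => (c s).z) t ^ 2
      + Real.exp (2 * (c t).z) * deriv (fun s => (c s).x) t ^ 2
      + Real.exp (-2 * (c t).z) * deriv (fun s => (c s).y) t ^ 2))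

/-- The Riemannian distance on `Sol`: the infimum of the lengths of the `C¹` curves that
join two points. -/
def riemDist (g h : Sol) : ENNReal :=
  ⨅ (c : ℝ → Sol) (_ : ContDiff ℝ 1 (fun t => ((c t).z, (c t).x, (c t).y)))
    (_ : c 0 = g) (_ : c 1 = h), curveLength c

/-- The measure `μ` on `Sol` has a finite first moment: `∫ d(id, g) dμ(g) < ∞`. -/
def HasFiniteFirstMoment (μ : Measure Sol) : Prop :=
  ∫⁻ g, riemDist 1 g ∂μ < ⊤

/-- The path `W 0 = id`, `W (n + 1) = W n * X n` with increments `X 0, X 1, …`. -/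
def walk (X : ℕ → Sol) : ℕ → Sol
  | 0 => 1
  | n + 1 => walk X n * X n

theorem measurable_walk : Measurable walk := by
  refine measurable_pi_iff.2 fun n => ?_
  induction n with
  | zero => exact measurable_const
  | succ n ih =>
    have hX : Measurable fun X : ℕ → Sol => X n := measurable_pi_apply n
    refine measurable_of_coords ?_ ?_ ?_
    · exact (measurable_z.comp ih).add (measurable_z.comp hX)
    · exact (measurable_x.comp ih).add
        ((Real.measurable_exp.comp (measurable_z.comp ih).neg).mul (measurable_x.comp hX))
    · exact (measurable_y.comp ih).add
        ((Real.measurable_exp.comp (measurable_z.comp ih)).mul (measurable_y.comp hX))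

/-- The law, on the space of paths, of the random walk that starts at `id` and has
independent increments of law `μ`. -/
def pathLaw (μ : Measure Sol) [IsProbabilityMeasure μ] : Measure (ℕ → Sol) :=
  (Measure.infinitePi fun _ : ℕ => μ).map walk

instance (μ : Measure Sol) [IsProbabilityMeasure μ] : IsProbabilityMeasure (pathLaw μ) :=
  Measure.isProbabilityMeasure_map measurable_walk.aemeasurable

/-- The boundary point `ξ` of a path `W` in `∂⁺Sol = ℝ`, the upward vertical geodesics: the
limit of the `x`-coordinates of `W` (with an arbitrary value if there is no limit). -/
def boundaryPoint (W : ℕ → Sol) : ℝ :=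
  limUnder atTop fun n => (W n).x

/-- The harmonic measure on `∂⁺Sol = ℝ` of the random walk of law `μ`: the distribution of
the boundary point `ξ`. -/
def harmonicMeasure (μ : Measure Sol) [IsProbabilityMeasure μ] : Measure ℝ :=
  (pathLaw μ).map boundaryPoint

end

end Sol

/-! Conditioning on the first increment shows that φ, the characteristic function of ν, satisfies
φ(t) = cos t · (p φ(t e^{-γ}) + (1 - p) φ(t e^{γ})) (`Sol.charFun_harmonicMeasure_eq`). For p = 1
iteration gives |φ(t)| ≤ ∏ |cos(t e^{-γn})|, the transform of a Bernoulli convolution. For p > 1/2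
the frequency performs a walk on t e^{γℤ} with drift towards 0; it must visit every t e^{-γn}, and a
factor cos is collected at each visit. A maximum principle (`le_prod_of_subharmonic_nat`) makes this
precise: the same product bounds |φ| for every p and μ, so the conditions on γ involve neither.

The decay of the product is the Erdős–Kahane argument. For θ in [8, 64], slow decay means that θ^j x
stays near integers for most j. Such integers mostly determine their successors, so there are few
such sequences; as ratios of consecutive terms determine θ, Borel–Cantelli discards a null set. The
rest has decay |t|^{-ε} with a uniform ε (`ae_exists_prod_cos_le`). Writing e^{-γ} as the m-th root
of θ⁻¹ splits the product into m such products and yields the exponent mε, which is large when γ is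
small (`ae_small_exists_prod_cos_le`). Decay of order k + 2 then gives a C^k density by Fourier
inversion (`exists_contDiff_density`). -/

namespace ErdosKahane

/-! ### Counting the integer sequences close to geometric progressions -/

/-- The prediction `s² / r`, rounded, of the term that follows `r, s` in a sequence of integers
close to a geometric progression. -/
noncomputable def predict (q : ℤ × ℤ) : ℤ := round ((q.2 : ℝ) ^ 2 / q.1)

/-- The pairs of consecutive integers that can be reached from a pair in `P` in `N` steps, at most
`m` of which deviate, by at most `A`, from the prediction. -/
noncomputable def reach (A : ℤ) (P : Finset (ℤ × ℤ)) : ℕ → ℕ → Finset (ℤ × ℤ)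
  | 0, _ => P
  | N + 1, 0 => (reach A P N 0).image fun q => (q.2, predict q)
  | N + 1, m + 1 => (reach A P N (m + 1)).image (fun q => (q.2, predict q)) ∪
      (reach A P N m).biUnion fun q =>
        (Finset.Icc (-A) A).image fun i => (q.2, predict q + i)

/-- A predicted step leaves one choice and a deviation at most 2A + 1. The factor 2^N pays for the
positions of the deviations, by the Pascal recursion on (N, m). -/
theorem card_reach_le (A : ℕ) (P : Finset (ℤ × ℤ)) (N m : ℕ) :
    (reach A P N m).card ≤ P.card * 2 ^ N * (2 * A + 1) ^ m := by
  induction N generalizing m with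
  | zero =>
    simp only [reach, pow_zero, mul_one]
    exact Nat.le_mul_of_pos_right _ (by positivity)
  | succ N ih =>
    cases m with
    | zero =>
      simp only [reach]
      refine Finset.card_image_le.trans ((ih 0).trans ?_)
      gcongr <;> omega
    | succ m =>
      simp only [reach]
      have hA : (Finset.Icc (-(A : ℤ)) A).card = 2 * A + 1 := by
        rw [Int.card_Icc]; omega
      have h2 : ((reach A P N m).biUnion fun q =>
          (Finset.Icc (-(A : ℤ)) A).image fun i => (q.2, predict q + i)).card ≤
          (reach A P N m).card * (2 * A + 1) := by
        refine Finset.card_biUnion_le_card_mul _ _ _ fun q _ => ?_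
        exact Finset.card_image_le.trans hA.le
      calc _ ≤ _ := Finset.card_union_le _ _
        _ ≤ P.card * 2 ^ N * (2 * A + 1) ^ (m + 1) +
            (P.card * 2 ^ N * (2 * A + 1) ^ m) * (2 * A + 1) := by
          refine add_le_add (Finset.card_image_le.trans (ih _)) (h2.trans ?_)
          gcongr
          exact ih m
        _ = _ := by ring

/-- The number of the first `N` steps of `r` that deviate from the prediction. -/
noncomputable def deviations (r : ℕ → ℤ) (N : ℕ) : ℕ :=
  ((Finset.range N).filter fun j => r (j + 2) ≠ predict (r j, r (j + 1))).card

theorem mem_reach {A : ℤ} {P : Finset (ℤ × ℤ)} {r : ℕ → ℤ} (h0 : (r 0, r 1) ∈ P)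
    (hA : ∀ j, |r (j + 2) - predict (r j, r (j + 1))| ≤ A) (N m : ℕ) (hm : deviations r N ≤ m) :
    (r N, r (N + 1)) ∈ reach A P N m := by
  induction N generalizing m with
  | zero => simpa [reach] using h0
  | succ N ih =>
    have hd : deviations r (N + 1) = deviations r N +
        if r (N + 2) ≠ predict (r N, r (N + 1)) then 1 else 0 := by
      unfold deviations
      rw [Finset.range_add_one, Finset.filter_insert]
      split_ifs with h
      · rw [Finset.card_insert_of_notMem (by simp)]
      · rfl
    by_cases h : r (N + 2) = predict (r N, r (N + 1))
    · have := ih m (by rw [hd] at hm; omega)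
      have key : (r (N + 1), r (N + 1 + 1)) ∈
          (reach A P N m).image fun q => (q.2, predict q) :=
        Finset.mem_image.2 ⟨_, this, by simp [← h]⟩
      cases m with
      | zero => exact key
      | succ m => exact Finset.mem_union_left _ key
    · rw [hd, if_pos h] at hm
      cases m with
      | zero => omega
      | succ m =>
        refine Finset.mem_union_right _ (Finset.mem_biUnion.2 ⟨_, ih m (by omega), ?_⟩)
        exact Finset.mem_image.2 ⟨r (N + 2) - predict (r N, r (N + 1)),
          Finset.mem_Icc.2 (abs_le.1 (hA N)), by simp⟩

/-! ### Rounding errors along a progression -/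

theorem round_facts {y : ℝ} (hy : 1 ≤ y) : (1 : ℝ) ≤ round y ∧ y ≤ 3 / 2 * round y := by
  have h := abs_le.1 (abs_sub_round y)
  have h1 : (0 : ℤ) < round y := by
    have : (0 : ℝ) < round y := by linarith
    exact_mod_cast this
  have h2 : (1 : ℝ) ≤ round y := by exact_mod_cast h1
  exact ⟨h2, by linarith⟩

/-- The exact terms satisfy y · θ²y = (θy)², so only rounding errors remain. With θ ≤ 64 and y ≤
(3/2) round y, the coefficients are 2·64·(3/2) + 1 = 193, the 1 coming from the quadratic error
term, and 64²·(3/2) = 6144. -/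
theorem abs_round_sub_le {θ y : ℝ} (hθ : 1 ≤ θ) (hθ' : θ ≤ 64) (hy : 1 ≤ y) :
    |(round (θ ^ 2 * y) : ℝ) - (round (θ * y) : ℝ) ^ 2 / round y| ≤
      |θ ^ 2 * y - round (θ ^ 2 * y)| + 193 * |θ * y - round (θ * y)|
        + 6144 * |y - round y| := by
  obtain ⟨h1, h2⟩ := round_facts hy
  have e' := abs_sub_round (θ * y)
  set r : ℝ := ((round y : ℤ) : ℝ)
  set r' : ℝ := ((round (θ * y) : ℤ) : ℝ)
  set r'' : ℝ := ((round (θ ^ 2 * y) : ℤ) : ℝ)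
  have hr : 0 < r := by linarith
  have key : r'' - r' ^ 2 / r = -(θ ^ 2 * y - r'') +
      (2 * θ * (y / r) * (θ * y - r') - (θ * y - r') * ((θ * y - r') / r)
        - θ ^ 2 * (y / r) * (y - r)) := by
    field_simp
    ring
  have hyr : y / r ≤ 3 / 2 := by rw [div_le_iff₀ hr]; linarith
  have hyr0 : 0 ≤ y / r := by positivity
  rw [key]
  have t1 : |2 * θ * (y / r) * (θ * y - r')| ≤ 192 * |θ * y - r'| := by
    rw [abs_mul, abs_of_nonneg (by positivity : 0 ≤ 2 * θ * (y / r))]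
    gcongr
    nlinarith
  have t2 : |(θ * y - r') * ((θ * y - r') / r)| ≤ 1 * |θ * y - r'| := by
    rw [abs_mul, mul_comm, abs_div, abs_of_pos hr]
    gcongr
    rw [div_le_one hr]; linarith
  have t3 : |θ ^ 2 * (y / r) * (y - r)| ≤ 6144 * |y - r| := by
    rw [abs_mul, abs_of_nonneg (by positivity : 0 ≤ θ ^ 2 * (y / r))]
    gcongr
    have : θ ^ 2 ≤ 4096 := by nlinarith
    nlinarith
  have a1 := abs_add_le (-(θ ^ 2 * y - r'')) (2 * θ * (y / r) * (θ * y - r')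
    - (θ * y - r') * ((θ * y - r') / r) - θ ^ 2 * (y / r) * (y - r))
  have a2 := abs_sub (2 * θ * (y / r) * (θ * y - r')
    - (θ * y - r') * ((θ * y - r') / r)) (θ ^ 2 * (y / r) * (y - r))
  have a3 := abs_sub (2 * θ * (y / r) * (θ * y - r')) ((θ * y - r') * ((θ * y - r') / r))
  rw [abs_neg] at a1
  linarith

/-- Errors of at most 1/2 give (1 + 193 + 6144)/2 = 3169, and rounding the quotient adds another
1/2. -/
theorem abs_round_sub_predict_le {θ y : ℝ} (hθ : 1 ≤ θ) (hθ' : θ ≤ 64) (hy : 1 ≤ y) :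
    |round (θ ^ 2 * y) - predict (round y, round (θ * y))| ≤ 3170 := by
  have h := abs_round_sub_le hθ hθ' hy
  have h1 := abs_sub_round (θ ^ 2 * y)
  have h2 := abs_sub_round (θ * y)
  have h3 := abs_sub_round y
  have h4 := abs_sub_round ((round (θ * y) : ℝ) ^ 2 / round y)
  have h5 := abs_sub_le (round (θ ^ 2 * y) : ℝ) ((round (θ * y) : ℝ) ^ 2 / round y)
    (round ((round (θ * y) : ℝ) ^ 2 / round y))
  have : |(round (θ ^ 2 * y) : ℝ) - (predict (round y, round (θ * y)) : ℤ)| ≤ (3170 : ℤ) := by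
    simp only [predict]
    push_cast
    linarith
  exact_mod_cast this

/-- The threshold is chosen so that (1 + 193 + 6144)/13000 < 1/2. Hence a deviation forces one of
three consecutive terms away from the integers, where the cosine is bounded away from 1 in absolute
value. -/
theorem round_eq_predict {θ y ρ : ℝ} (hθ : 1 ≤ θ) (hθ' : θ ≤ 64) (hy : 1 ≤ y)
    (hρ : ρ ≤ 1 / 13000)
    (h0 : |y - round y| ≤ ρ) (h1 : |θ * y - round (θ * y)| ≤ ρ)
    (h2 : |θ ^ 2 * y - round (θ ^ 2 * y)| ≤ ρ) :
    round (θ ^ 2 * y) = predict (round y, round (θ * y)) := by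
  have h := abs_round_sub_le hθ hθ' hy
  have h4 : |((round (θ * y) : ℝ) ^ 2 / round y) - (round (θ ^ 2 * y) : ℤ)| < 1 / 2 := by
    rw [abs_sub_comm]; linarith
  simp only [predict]
  symm
  rw [round_eq, Int.floor_eq_iff]
  rw [abs_lt] at h4
  constructor <;> linarith

theorem abs_cos_pi_mul_le {y ρ : ℝ} (hρ : 0 ≤ ρ) (h : ρ ≤ |y - round y|) :
    |Real.cos (Real.pi * y)| ≤ Real.cos (Real.pi * ρ) := by
  have hh := abs_sub_round y
  have e : Real.cos (Real.pi * y) = (-1) ^ (round y) * Real.cos (Real.pi * |y - round y|) := by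
    have h1 : Real.cos (Real.pi * |y - round y|) = Real.cos (Real.pi * y - round y * Real.pi) := by
      rw [← Real.cos_abs (Real.pi * y - round y * Real.pi), ← abs_of_pos Real.pi_pos, ← abs_mul,
        abs_of_pos Real.pi_pos]
      ring_nf
    rw [h1, Real.cos_sub_int_mul_pi, ← mul_assoc, ← mul_zpow]
    simp
  rw [e, abs_mul, abs_zpow, abs_neg, abs_one, one_zpow, one_mul]
  have hp := Real.pi_pos
  rw [abs_of_nonneg (Real.cos_nonneg_of_neg_pi_div_two_le_of_le
    (by have := abs_nonneg (y - round y); nlinarith) (by nlinarith))]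
  exact Real.cos_le_cos_of_nonneg_of_le_pi (by positivity) (by nlinarith) (by gcongr)

end ErdosKahane

/-! ### The exceptional parameters and the product of cosines -/

namespace ErdosKahane

/-- The triples attached to different deviations may overlap. Three copies of the product, shifted
by 0, 1 and 2, provide a separate triple for each j; this accounts for the cube. -/
theorem prod_pow_three_le {c : ℕ → ℝ} (h0 : ∀ j, 0 ≤ c j) (h1 : ∀ j, c j ≤ 1) {κ : ℝ}
    {r : ℕ → ℤ}
    (h : ∀ j, r (j + 2) ≠ predict (r j, r (j + 1)) → c j * c (j + 1) * c (j + 2) ≤ κ) (N : ℕ) :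
    (∏ j ∈ Finset.range (N + 2), c j) ^ 3 ≤ κ ^ deviations r N := by
  have a1 : ∏ j ∈ Finset.range (N + 2), c j ≤ ∏ j ∈ Finset.range N, c j := by
    rw [Finset.prod_range_succ, Finset.prod_range_succ, mul_assoc]
    exact mul_le_of_le_one_right (Finset.prod_nonneg fun j _ => h0 j)
      (mul_le_one₀ (h1 _) (h0 _) (h1 _))
  have a2 : ∏ j ∈ Finset.range (N + 2), c j ≤ ∏ j ∈ Finset.range N, c (j + 1) := by
    rw [Finset.prod_range_succ, Finset.prod_range_succ', mul_assoc]
    exact mul_le_of_le_one_right (Finset.prod_nonneg fun j _ => h0 _)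
      (mul_le_one₀ (h1 _) (h0 _) (h1 _))
  have a3 : ∏ j ∈ Finset.range (N + 2), c j ≤ ∏ j ∈ Finset.range N, c (j + 2) := by
    rw [Finset.prod_range_succ', Finset.prod_range_succ', mul_assoc]
    exact mul_le_of_le_one_right (Finset.prod_nonneg fun j _ => h0 _)
      (mul_le_one₀ (h1 _) (h0 _) (h1 _))
  have p0 : 0 ≤ ∏ j ∈ Finset.range (N + 2), c j := Finset.prod_nonneg fun j _ => h0 j
  calc (∏ j ∈ Finset.range (N + 2), c j) ^ 3
      = (∏ j ∈ Finset.range (N + 2), c j) * (∏ j ∈ Finset.range (N + 2), c j) *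
        (∏ j ∈ Finset.range (N + 2), c j) := by ring
    _ ≤ (∏ j ∈ Finset.range N, c j) * (∏ j ∈ Finset.range N, c (j + 1)) *
        ∏ j ∈ Finset.range N, c (j + 2) := by
      have q1 : 0 ≤ ∏ j ∈ Finset.range N, c j := Finset.prod_nonneg fun j _ => h0 _
      have q2 : 0 ≤ ∏ j ∈ Finset.range N, c (j + 1) := Finset.prod_nonneg fun j _ => h0 _
      gcongr
    _ = ∏ j ∈ Finset.range N, c j * c (j + 1) * c (j + 2) := by
      rw [Finset.prod_mul_distrib, Finset.prod_mul_distrib]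
    _ ≤ ∏ j ∈ Finset.range N, if r (j + 2) ≠ predict (r j, r (j + 1)) then κ else 1 := by
      refine Finset.prod_le_prod
        (fun j _ => mul_nonneg (mul_nonneg (h0 _) (h0 _)) (h0 _)) fun j _ => ?_
      split_ifs with hj
      · exact h j hj
      · exact mul_le_one₀ (mul_le_one₀ (h1 _) (h0 _) (h1 _)) (h0 _) (h1 _)
    _ = κ ^ deviations r N := by
      rw [Finset.prod_ite, Finset.prod_const, Finset.prod_const_one, mul_one]
      rfl

/-- The contraction factor gained at each deviation. -/
noncomputable def kappa : ℝ := Real.cos (Real.pi * (1 / 13000))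

theorem kappa_pos : 0 < kappa := by
  have := Real.pi_pos
  exact Real.cos_pos_of_mem_Ioo ⟨by linarith, by linarith⟩

theorem kappa_lt_one : kappa < 1 := by
  have := Real.pi_pos
  rw [← Real.cos_zero]
  exact Real.cos_lt_cos_of_nonneg_of_le_pi le_rfl (by linarith) (by linarith)

/-- The pairs of integers between `0` and `K`. -/
noncomputable def box (K : ℕ) : Finset (ℤ × ℤ) := Finset.Icc 0 (K : ℤ) ×ˢ Finset.Icc 0 (K : ℤ)

theorem round_mem_box {K : ℕ} {y z : ℝ} (hy : 1 ≤ y) (hy' : y + 1 ≤ K) (hz : 1 ≤ z)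
    (hz' : z + 1 ≤ K) : (round y, round z) ∈ box K := by
  have hP : ∀ y : ℝ, 1 ≤ y → y + 1 ≤ K → 0 ≤ round y ∧ round y ≤ (K : ℤ) := by
    intro y h1 h2
    have h3 := abs_le.1 (abs_sub_round y)
    constructor
    · have : (0 : ℝ) ≤ round y := by linarith
      exact_mod_cast this
    · have : (round y : ℝ) ≤ K := by linarith
      exact_mod_cast this
  rw [box, Finset.mem_product, Finset.mem_Icc, Finset.mem_Icc]
  exact ⟨hP y hy hy', hP z hz hz'⟩

/-- The initial pairs of integers. -/
noncomputable def initialPairs : Finset (ℤ × ℤ) := box ⌈(64 : ℝ) ^ 9 + 1⌉₊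

theorem round_mem_initialPairs {y z : ℝ} (hy : 1 ≤ y) (hy' : y ≤ 64 ^ 9) (hz : 1 ≤ z)
    (hz' : z ≤ 64 ^ 9) : (round y, round z) ∈ initialPairs := by
  have h := Nat.le_ceil ((64 : ℝ) ^ 9 + 1)
  exact round_mem_box hy (by linarith) hz (by linarith)

/-- The set that contains each `θ` for which some progression of ratio `θ` stays so close to the
integers that at most `m` of its first `8 m` steps deviate from the prediction. -/
def exceptional (m : ℕ) : Set ℝ :=
  ⋃ q ∈ reach 3170 initialPairs (8 * m) m,
    Metric.closedBall ((q.2 : ℝ) / q.1) (50 / 8 ^ (8 * m))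

/-- The number of centres grows like (2^8 · 6341)^m, while the radii shrink like 8^{-8m}. One
deviation in eight steps is rare enough for the ratio to be below 1. -/
theorem volume_exceptional_le (m : ℕ) :
    volume (exceptional m) ≤
      ENNReal.ofReal (initialPairs.card * 100 * (2 ^ 8 * 6341 / 8 ^ 8) ^ m) := by
  refine (measure_biUnion_finset_le _ _).trans ?_
  simp only [Real.volume_closedBall, Finset.sum_const, nsmul_eq_mul]
  rw [← ENNReal.ofReal_natCast, ← ENNReal.ofReal_mul (by positivity)]
  refine ENNReal.ofReal_le_ofReal ?_
  have h : ((reach (3170 : ℕ) initialPairs (8 * m) m).card : ℝ) ≤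
      initialPairs.card * 2 ^ (8 * m) * (2 * (3170 : ℕ) + 1) ^ m := by
    exact_mod_cast card_reach_le 3170 initialPairs (8 * m) m
  calc _ ≤ (initialPairs.card * 2 ^ (8 * m) * (2 * (3170 : ℕ) + 1) ^ m : ℝ) *
        (2 * (50 / 8 ^ (8 * m))) := by gcongr; exact_mod_cast h
    _ = _ := by
      generalize initialPairs.card = n
      rw [div_pow, mul_pow, ← pow_mul, ← pow_mul]
      push_cast
      norm_num
      ring

theorem ae_eventually_notMem_exceptional :
    ∀ᵐ θ : ℝ, ∀ᶠ m in atTop, θ ∉ exceptional m := by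
  refine ae_eventually_notMem (ne_top_of_le_ne_top ?_ (ENNReal.tsum_le_tsum volume_exceptional_le))
  have hs : Summable fun m : ℕ =>
      (initialPairs.card * 100 * (2 ^ 8 * 6341 / 8 ^ 8) ^ m : ℝ) :=
    (summable_geometric_of_lt_one (by norm_num) (by norm_num)).mul_left _
  exact hs.tsum_ofReal_ne_top

/-- The quotient of the last two integers recovers θ with error at most (65/2)/round y, where y ≥
8^{8m} and y ≤ (3/2) round y. Since (65/2)·(3/2) < 50, θ lies in one of the balls. -/
theorem mem_exceptional {θ x : ℝ} (hθ : 8 ≤ θ) (hθ' : θ ≤ 64) (hx : 1 ≤ x) (hx' : x ≤ 64 ^ 8)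
    {m : ℕ} (hm : deviations (fun j => round (θ ^ j * x)) (8 * m) ≤ m) : θ ∈ exceptional m := by
  have hy : ∀ j : ℕ, 1 ≤ θ ^ j * x := fun j =>
    one_le_mul_of_one_le_of_one_le (one_le_pow₀ (by linarith)) hx
  have h0 : (round (θ ^ 0 * x), round (θ ^ 1 * x)) ∈ initialPairs := by
    refine round_mem_initialPairs (hy 0) ?_ (hy 1) ?_
    · rw [pow_zero, one_mul]; linarith
    · rw [pow_one]
      calc θ * x ≤ 64 * 64 ^ 8 := by gcongr
        _ = 64 ^ 9 := by ring
  have hmem := mem_reach (A := 3170) (P := initialPairs)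
    (r := fun j => round (θ ^ j * x))
    h0
    (fun j => by
      have := abs_round_sub_predict_le (by linarith) hθ' (hy j)
      rw [← mul_assoc, ← mul_assoc, ← pow_add, ← pow_succ', add_comm 2 j] at this
      exact this) (8 * m) m hm
  refine Set.mem_iUnion₂.2 ⟨_, hmem, ?_⟩
  obtain ⟨h1, h2⟩ := round_facts (hy (8 * m))
  have e1 := abs_sub_round (θ ^ (8 * m) * x)
  have e2 := abs_sub_round (θ ^ (8 * m + 1) * x)
  rw [Metric.mem_closedBall, Real.dist_eq]
  simp only
  set y := θ ^ (8 * m) * x with hydef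
  have hy' : θ ^ (8 * m + 1) * x = θ * y := by rw [hydef]; ring
  rw [hy'] at e2 ⊢
  have h8 : (8 : ℝ) ^ (8 * m) ≤ y := by
    rw [hydef]
    calc (8 : ℝ) ^ (8 * m) ≤ θ ^ (8 * m) := by gcongr
      _ ≤ _ := le_mul_of_one_le_right (by positivity) hx
  set r : ℝ := ((round y : ℤ) : ℝ)
  set r' : ℝ := ((round (θ * y) : ℤ) : ℝ)
  have hr : 0 < r := by linarith
  have key : θ - r' / r = ((θ * y - r') - θ * (y - r)) / r := by field_simp; ring
  rw [key, abs_div, abs_of_pos hr, div_le_div_iff₀ hr (by positivity)]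
  have a1 := abs_sub (θ * y - r') (θ * (y - r))
  have a2 : |θ * (y - r)| ≤ 64 * (1 / 2) := by
    rw [abs_mul, abs_of_pos (by linarith : 0 < θ)]; gcongr
  calc _ ≤ (65 / 2 : ℝ) * 8 ^ (8 * m) := by gcongr; linarith
    _ ≤ 50 * r := by linarith

theorem prod_abs_cos_pow_three_le {θ x : ℝ} (hθ : 8 ≤ θ) (hθ' : θ ≤ 64) (hx : 1 ≤ x)
    (hx' : x ≤ 64 ^ 8) {m : ℕ} (hm : θ ∉ exceptional m) :
    (∏ j ∈ Finset.range (8 * m + 2), |Real.cos (Real.pi * (θ ^ j * x))|) ^ 3 ≤ kappa ^ m := by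
  have hd : m ≤ deviations (fun j => round (θ ^ j * x)) (8 * m) := by
    by_contra h
    exact hm (mem_exceptional hθ hθ' hx hx' (by omega))
  refine (prod_pow_three_le (κ := kappa) (r := fun j => round (θ ^ j * x))
    (fun j => abs_nonneg _) (fun j => Real.abs_cos_le_one _) ?_ (8 * m)).trans
    (pow_le_pow_of_le_one kappa_pos.le kappa_lt_one.le hd)
  intro j hj
  have c1 : ∀ j, |Real.cos (Real.pi * (θ ^ j * x))| ≤ 1 := fun j => Real.abs_cos_le_one _
  have c0 : ∀ j, 0 ≤ |Real.cos (Real.pi * (θ ^ j * x))| := fun j => abs_nonneg _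
  have hk : ∀ i, 1 / 13000 ≤ |θ ^ i * x - round (θ ^ i * x)| →
      |Real.cos (Real.pi * (θ ^ i * x))| ≤ kappa := fun i hi =>
    abs_cos_pi_mul_le (by norm_num) hi
  rcases le_or_gt (1 / 13000) |θ ^ j * x - round (θ ^ j * x)| with g0 | g0
  · rw [mul_assoc]
    exact (mul_le_of_le_one_right (c0 _) (mul_le_one₀ (c1 _) (c0 _) (c1 _))).trans (hk _ g0)
  rcases le_or_gt (1 / 13000) |θ ^ (j + 1) * x - round (θ ^ (j + 1) * x)| with g1 | g1
  · exact (mul_le_of_le_one_right (mul_nonneg (c0 _) (c0 _)) (c1 _)).trans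
      ((mul_le_of_le_one_left (c0 _) (c1 _)).trans (hk _ g1))
  rcases le_or_gt (1 / 13000) |θ ^ (j + 2) * x - round (θ ^ (j + 2) * x)| with g2 | g2
  · exact (mul_le_of_le_one_left (c0 _) (mul_le_one₀ (c1 _) (c0 _) (c1 _))).trans (hk _ g2)
  refine absurd ?_ hj
  have := round_eq_predict (θ := θ) (y := θ ^ j * x) (by linarith) hθ'
    (one_le_mul_of_one_le_of_one_le (one_le_pow₀ (by linarith)) hx) le_rfl g0.le
    (by rw [← mul_assoc, ← pow_succ']; exact g1.le)
    (by rw [← mul_assoc, ← pow_add, add_comm 2 j]; exact g2.le)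
  rw [← mul_assoc, ← mul_assoc, ← pow_add, ← pow_succ', add_comm 2 j] at this
  exact this

end ErdosKahane

/-! ### Power decay for Bernoulli convolutions -/

namespace ErdosKahane

/-- A block of eight steps multiplies the frequency by at most 64^8 and the cube of the product by
`kappa`; ε expresses this gain as a power of the frequency. -/
theorem exists_exponent : ∃ ε : ℝ, 0 < ε ∧ kappa = (((64 : ℝ) ^ 8) ^ (-ε)) ^ 3 := by
  have h64 : 0 < Real.log (64 ^ 8) := Real.log_pos (by norm_num)
  refine ⟨-Real.log kappa / (3 * Real.log (64 ^ 8)),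
    div_pos (neg_pos.2 (Real.log_neg kappa_pos kappa_lt_one)) (by positivity), ?_⟩
  rw [Real.rpow_def_of_pos (by norm_num), ← Real.exp_nat_mul]
  conv_lhs => rw [← Real.exp_log kappa_pos]
  congr 1
  field_simp
  norm_num

/-- The Erdős–Kahane theorem: for almost every `θ` in `[8, 64]` the Fourier transform of the
Bernoulli convolution of parameter `θ⁻¹` has a power decay, with a uniform exponent. -/
theorem ae_exists_prod_cos_le : ∃ ε : ℝ, 0 < ε ∧ ∀ᵐ θ : ℝ, 8 ≤ θ → θ ≤ 64 →
    ∃ C : ℝ, 0 < C ∧ ∀ t : ℝ, 0 ≤ t → ∃ N : ℕ,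
      ∏ n ∈ Finset.range N, |Real.cos (t * θ⁻¹ ^ n)| ≤ C * (1 + t) ^ (-ε) := by
  obtain ⟨ε, hε, hκ⟩ := exists_exponent
  refine ⟨ε, hε, ?_⟩
  filter_upwards [ae_eventually_notMem_exceptional] with θ hθm hθ hθ'
  obtain ⟨m₀, hm₀⟩ := eventually_atTop.1 hθm
  have hπ := Real.pi_pos
  have hπ3 := Real.pi_gt_three
  have hθ0 : 0 < θ := by linarith
  set T : ℝ := Real.pi * θ * (θ ^ 8) ^ m₀ with hT
  set D : ℝ := 2 * Real.pi * 64 ^ 9 with hD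
  have hT0 : 0 < T := by positivity
  have hD0 : 0 < D := by positivity
  -- The first summand absorbs t < T, where the empty product suffices. The second serves t ≥ T,
  -- where at least `m₀` blocks fit below t.
  refine ⟨(1 + T) ^ ε + D ^ ε, by positivity, fun t ht => ?_⟩
  rcases lt_or_ge t T with htT | htT
  · refine ⟨0, ?_⟩
    rw [Finset.prod_range_zero, Real.rpow_neg (by positivity), ← div_eq_mul_inv,
      le_div_iff₀ (by positivity), one_mul]
    have : (1 + t) ^ ε ≤ (1 + T) ^ ε := by gcongr
    have : 0 ≤ D ^ ε := by positivity
    linarith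
  · have h8 : 1 < θ ^ 8 := one_lt_pow₀ (by linarith) (by norm_num)
    have hx0 : (θ ^ 8) ^ m₀ ≤ t / (Real.pi * θ) := by
      rw [le_div_iff₀ (by positivity)]; linarith
    -- With this m, t = π θ^{8m+1} x and x ∈ [1, θ^8]. The 8m + 2 factors, read backwards, have
    -- arguments π θ^j x for j ≤ 8m + 1.
    obtain ⟨m, hm1, hm2⟩ := exists_nat_pow_near ((one_le_pow₀ h8.le).trans hx0) h8
    have hm : m₀ ≤ m := by
      have := (pow_lt_pow_iff_right₀ h8).1 (hx0.trans_lt hm2)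
      omega
    have ht1 : 1 ≤ t := by
      refine le_trans ?_ htT
      have := one_le_pow₀ (n := m₀) h8.le
      have h3 : 1 ≤ Real.pi * θ := by nlinarith
      exact one_le_mul_of_one_le_of_one_le h3 this
    set x : ℝ := t / (Real.pi * θ) / (θ ^ 8) ^ m with hx
    have hx1 : 1 ≤ x := by rw [hx, le_div_iff₀ (by positivity)]; linarith
    have hx2 : x ≤ θ ^ 8 := by
      rw [hx, div_le_iff₀ (by positivity), ← pow_succ']; exact hm2.le
    have htx : t = Real.pi * (θ ^ (8 * m + 1) * x) := by
      rw [hx, pow_succ, pow_mul]; field_simp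
    refine ⟨8 * m + 2, ?_⟩
    have hx3 : x ≤ 64 ^ 8 := hx2.trans (by gcongr)
    have key := prod_abs_cos_pow_three_le hθ hθ' hx1 hx3 (hm₀ m hm)
    rw [hκ, ← pow_mul, mul_comm 3 m, pow_mul] at key
    have key2 := le_of_pow_le_pow_left₀ three_ne_zero (by positivity) key
    have e : ∏ n ∈ Finset.range (8 * m + 2), |Real.cos (t * θ⁻¹ ^ n)| =
        ∏ j ∈ Finset.range (8 * m + 2), |Real.cos (Real.pi * (θ ^ j * x))| := by
      rw [← Finset.prod_range_reflect]
      refine Finset.prod_congr rfl fun j hj => ?_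
      have hj' := Finset.mem_range.1 hj
      obtain ⟨i, hi⟩ : ∃ i, 8 * m + 1 = j + i := ⟨8 * m + 1 - j, by omega⟩
      have : t * θ⁻¹ ^ (8 * m + 2 - 1 - j) = Real.pi * (θ ^ j * x) := by
        rw [show 8 * m + 2 - 1 - j = i by omega, htx, hi, pow_add, inv_pow]
        field_simp
      rw [this]
    rw [e]
    refine key2.trans ?_
    have ht2 : 1 + t ≤ D * (64 ^ 8) ^ m := by
      calc 1 + t ≤ 2 * t := by linarith
        _ = 2 * (Real.pi * (θ * (θ ^ 8) ^ m * x)) := by rw [htx, pow_succ', pow_mul]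
        _ ≤ 2 * (Real.pi * (64 * (64 ^ 8) ^ m * 64 ^ 8)) := by gcongr
        _ = _ := by rw [hD]; ring
    have h1 : ((64 ^ 8 : ℝ) ^ (-ε)) ^ m = D ^ ε * (D * (64 ^ 8) ^ m) ^ (-ε) := by
      rw [Real.mul_rpow hD0.le (by positivity), ← mul_assoc, ← Real.rpow_add hD0, add_neg_cancel,
        Real.rpow_zero, one_mul, ← Real.rpow_natCast, ← Real.rpow_natCast (n := m),
        ← Real.rpow_mul (by positivity), ← Real.rpow_mul (by positivity), mul_comm]
    rw [h1]
    have h2 : (D * (64 ^ 8) ^ m) ^ (-ε) ≤ (1 + t) ^ (-ε) :=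
      Real.rpow_le_rpow_of_nonpos (by linarith) ht2 (by linarith)
    have h3 : 0 ≤ (1 + T) ^ ε := by positivity
    have h4 : 0 ≤ D ^ ε := by positivity
    gcongr
    linarith

theorem prod_range_mul_eq (f : ℕ → ℝ) (m N : ℕ) :
    ∏ n ∈ Finset.range (m * N), f n =
      ∏ i ∈ Finset.range m, ∏ n ∈ Finset.range N, f (m * n + i) := by
  induction N with
  | zero => simp
  | succ N ih =>
    rw [mul_add, mul_one, Finset.prod_range_add, ih, ← Finset.prod_mul_distrib]
    exact Finset.prod_congr rfl fun i _ => (Finset.prod_range_succ _ _).symm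

theorem prod_cos_antitone (t a : ℝ) :
    Antitone fun N : ℕ => ∏ n ∈ Finset.range N, |Real.cos (t * a ^ n)| := by
  refine antitone_nat_of_succ_le fun N => ?_
  rw [Finset.prod_range_succ]
  exact mul_le_of_le_one_right (Finset.prod_nonneg fun _ _ => abs_nonneg _) (Real.abs_cos_le_one _)

/-- Taking an `m`-th root of the parameter multiplies the exponent of decay by `m`. -/
theorem exists_prod_cos_le_of_pow {ε C a : ℝ} {m : ℕ} (hε : 0 < ε) (hC : 0 < C)
    (ha : 0 < a) (ha1 : a ≤ 1)
    (h : ∀ t : ℝ, 0 ≤ t → ∃ N : ℕ,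
      ∏ n ∈ Finset.range N, |Real.cos (t * (a ^ m) ^ n)| ≤ C * (1 + t) ^ (-ε))
    {t : ℝ} (ht : 0 ≤ t) :
    ∃ N : ℕ, ∏ n ∈ Finset.range N, |Real.cos (t * a ^ n)| ≤
      (C * (a ^ m) ^ (-ε)) ^ m * (1 + t) ^ (-(ε * m)) := by
  -- The factors are sorted by their index modulo m: each class i is a product for the parameter a^m
  -- at frequency t a^i. Lengths are made equal by their supremum, as longer products are smaller.
  choose N hN using fun i : ℕ => h (t * a ^ i) (by positivity)
  refine ⟨m * (Finset.range m).sup N, ?_⟩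
  rw [prod_range_mul_eq]
  have hb : ∀ i ∈ Finset.range m, ∏ n ∈ Finset.range ((Finset.range m).sup N),
      |Real.cos (t * a ^ (m * n + i))| ≤ C * (a ^ m) ^ (-ε) * (1 + t) ^ (-ε) := by
    intro i hi
    have e : ∀ n, t * a ^ (m * n + i) = t * a ^ i * (a ^ m) ^ n := fun n => by
      rw [pow_add, pow_mul]; ring
    simp only [e]
    refine (prod_cos_antitone _ _ (Finset.le_sup hi)).trans ((hN i).trans ?_)
    rw [mul_assoc, ← Real.mul_rpow (by positivity) (by positivity)]
    refine mul_le_mul_of_nonneg_left ?_ hC.le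
    refine Real.rpow_le_rpow_of_nonpos (by positivity) ?_ (by linarith)
    have h1 : a ^ m ≤ a ^ i := pow_le_pow_of_le_one ha.le ha1 (Finset.mem_range.1 hi).le
    have h2 : a ^ m ≤ 1 := pow_le_one₀ ha.le ha1
    nlinarith
  refine (Finset.prod_le_prod (fun i _ => Finset.prod_nonneg fun _ _ => abs_nonneg _) hb).trans
    (le_of_eq ?_)
  rw [Finset.prod_const, Finset.card_range, mul_pow]
  congr 1
  rw [← Real.rpow_natCast, ← Real.rpow_mul (by positivity), neg_mul]

/-- For every exponent `K` and almost every small `γ`, the Fourier transform of the Bernoulli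
convolution of parameter `e^{-γ}` is `O(|t|^{-K})`. -/
theorem ae_small_exists_prod_cos_le (K : ℕ) : ∃ γK : ℝ, 0 < γK ∧
    ∀ᵐ γ : ℝ, 0 < γ → γ < γK → ∃ C : ℝ, ∀ t : ℝ, 0 ≤ t → ∃ N : ℕ,
      ∏ n ∈ Finset.range N, |Real.cos (t * Real.exp (-γ) ^ n)| ≤ C * (1 + t) ^ (-(K : ℝ)) := by
  obtain ⟨ε, hε, hae⟩ := ae_exists_prod_cos_le
  obtain ⟨m₀, hm₀⟩ := exists_nat_ge (K / ε)
  have h64 : 0 < Real.log 64 := Real.log_pos (by norm_num)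
  have h8 : Real.log 64 = 2 * Real.log 8 := by
    rw [show (64 : ℝ) = 8 ^ 2 by norm_num, Real.log_pow]; norm_num
  refine ⟨Real.log 64 / (m₀ + 1), by positivity, ?_⟩
  set G : Set ℝ := {θ : ℝ | 8 ≤ θ → θ ≤ 64 →
    ∃ C : ℝ, 0 < C ∧ ∀ t : ℝ, 0 ≤ t → ∃ N : ℕ,
      ∏ n ∈ Finset.range N, |Real.cos (t * θ⁻¹ ^ n)| ≤ C * (1 + t) ^ (-ε)} with hG
  -- The map θ ↦ log θ / m is differentiable on [8, 64] and so preserves null sets; only countably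
  -- many m occur.
  have hnull : ∀ m : ℕ, volume ((fun θ : ℝ => Real.log θ / m) '' (Gᶜ ∩ Set.Icc 8 64)) = 0 := by
    intro m
    refine addHaar_image_eq_zero_of_differentiableOn_of_addHaar_eq_zero _ ?_
      (measure_mono_null Set.inter_subset_left hae)
    intro θ hθ
    have : θ ≠ 0 := by have := hθ.2.1; positivity
    exact ((Real.differentiableAt_log this).div_const _).differentiableWithinAt
  have hall : ∀ᵐ γ : ℝ, ∀ m : ℕ, γ ∉ (fun θ : ℝ => Real.log θ / m) '' (Gᶜ ∩ Set.Icc 8 64) :=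
    ae_all_iff.2 fun m => measure_eq_zero_iff_ae_notMem.1 (hnull m)
  filter_upwards [hall] with γ hγ h0 h1
  -- As log 64 = 2 log 8 and m ≥ 1, this largest multiple of γ below log 64 is still at least log 8,
  -- so e^{mγ} lies in [8, 64]. Small γ makes m large enough for mε ≥ K.
  set m := ⌊Real.log 64 / γ⌋₊ with hm
  have hm1 : (m : ℝ) * γ ≤ Real.log 64 := by
    rw [← le_div_iff₀ h0]; exact Nat.floor_le (by positivity)
  have hm2 : Real.log 64 < (m + 1) * γ := by
    rw [← div_lt_iff₀ h0]; exact Nat.lt_floor_add_one _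
  have hm3 : m₀ + 1 ≤ m := by
    rw [hm]
    refine Nat.le_floor ?_
    rw [lt_div_iff₀ (by positivity)] at h1
    rw [le_div_iff₀ h0]
    push_cast
    linarith
  have hm4 : (m₀ : ℝ) + 1 ≤ m := by exact_mod_cast hm3
  have hm5 : (1 : ℝ) ≤ m := by have : (0 : ℝ) ≤ m₀ := by positivity
                               linarith
  set θ := Real.exp (m * γ) with hθ
  have hθ8 : 8 ≤ θ := by
    rw [hθ, ← Real.log_le_iff_le_exp (by norm_num)]
    nlinarith
  have hθ64 : θ ≤ 64 := by
    rw [hθ, ← Real.le_log_iff_exp_le (by norm_num)]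
    exact hm1
  have hθG : θ ∈ G := by
    by_contra h
    refine hγ m ⟨θ, ⟨h, hθ8, hθ64⟩, ?_⟩
    have : (m : ℝ) ≠ 0 := by positivity
    simp only [hθ, Real.log_exp]
    field_simp
  obtain ⟨C, hC, hdec⟩ := hθG hθ8 hθ64
  have hinv : θ⁻¹ = Real.exp (-γ) ^ m := by
    rw [hθ, ← Real.exp_neg, ← Real.exp_nat_mul]; congr 1; ring
  rw [hinv] at hdec
  refine ⟨(C * (Real.exp (-γ) ^ m) ^ (-ε)) ^ m, fun t ht => ?_⟩
  obtain ⟨N, hN⟩ := exists_prod_cos_le_of_pow hε hC (Real.exp_pos _)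
    (Real.exp_le_one_iff.2 (by linarith)) hdec ht
  refine ⟨N, hN.trans ?_⟩
  gcongr
  · linarith
  · rw [div_le_iff₀ hε] at hm₀
    nlinarith

end ErdosKahane

/-! ### Maximum principle for the functional equation -/

/-- A maximum principle for the nearest-neighbour walk on `ℕ` that is killed with probabilities
`1 - c k`, drifts to `0`, and is stopped there. -/
theorem le_prod_of_subharmonic_nat {p : ℝ} (hp : 1 / 2 < p) (hp1 : p ≤ 1) {u c : ℕ → ℝ}
    (hu : ∀ k, u k ≤ 1) (hc0 : ∀ k, 0 ≤ c k) (hc1 : ∀ k, c k ≤ 1)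
    (h : ∀ k, u (k + 1) ≤ c k * (p * u k + (1 - p) * u (k + 2))) (k : ℕ) :
    u k ≤ ∏ j ∈ Finset.range k, c j := by
  set B : ℕ → ℝ := fun k => ∏ j ∈ Finset.range k, c j with hB
  have hB0 : ∀ k, 0 ≤ B k := fun k => Finset.prod_nonneg fun j _ => hc0 j
  have hBs : ∀ k, B (k + 1) = c k * B k := fun k => by
    simp only [hB]; rw [Finset.prod_range_succ, mul_comm]
  have hR : 1 < 2 * p := by linarith
  -- The barrier δ(2p)^k grows beyond the bounded u, so a positive maximum of the difference is
  -- attained. It is a supersolution because 2p - p - (1 - p)(2p)² = p(2p - 1)²; unlike ((p/(1 -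
  -- p))^k), it also makes sense for p = 1.
  suffices H : ∀ δ : ℝ, 0 < δ → u k - B k - δ * (2 * p) ^ k ≤ 0 by
    refine le_of_forall_pos_le_add fun ε hε => ?_
    have := H (ε / (2 * p) ^ k) (by positivity)
    rw [div_mul_cancel₀ _ (by positivity)] at this
    linarith
  intro δ hδ
  set v : ℕ → ℝ := fun k => u k - B k - δ * (2 * p) ^ k with hv
  by_contra! hpos
  have hstep : ∀ k, v (k + 1) ≤ c k * (p * v k + (1 - p) * v (k + 2)) := by
    intro k
    have h1 : c k * B (k + 2) ≤ B (k + 1) := by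
      rw [hBs (k + 1)]
      have : c (k + 1) * B (k + 1) ≤ B (k + 1) := mul_le_of_le_one_left (hB0 _) (hc1 _)
      exact (mul_le_of_le_one_left (mul_nonneg (hc0 _) (hB0 _)) (hc1 k)).trans this
    have h2 : c k * (δ * (2 * p) ^ k * (p + (1 - p) * (2 * p) ^ 2)) ≤ δ * (2 * p) ^ (k + 1) := by
      have h3 : p + (1 - p) * (2 * p) ^ 2 ≤ 2 * p := by
        nlinarith [mul_nonneg (by linarith : 0 ≤ p) (sq_nonneg (2 * p - 1))]
      have h5 : 0 ≤ p + (1 - p) * (2 * p) ^ 2 :=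
        add_nonneg (by linarith) (mul_nonneg (by linarith) (sq_nonneg _))
      calc _ ≤ 1 * (δ * (2 * p) ^ k * (2 * p)) := by gcongr; exact hc1 k
        _ = _ := by ring
    have h4 : c k * (p * v k + (1 - p) * v (k + 2)) =
        c k * (p * u k + (1 - p) * u (k + 2)) - p * (c k * B k) - (1 - p) * (c k * B (k + 2))
          - c k * (δ * (2 * p) ^ k * (p + (1 - p) * (2 * p) ^ 2)) := by
      simp only [hv]; ring
    have h5 : (1 - p) * (c k * B (k + 2)) ≤ (1 - p) * B (k + 1) :=
      mul_le_mul_of_nonneg_left h1 (by linarith)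
    rw [h4, ← hBs]
    have := h k
    simp only [hv]
    linarith
  obtain ⟨K, hK⟩ : ∃ K, ∀ k, K ≤ k → v k ≤ 0 := by
    obtain ⟨K, hK⟩ := pow_unbounded_of_one_lt (1 / δ) hR
    refine ⟨K, fun k hk => ?_⟩
    have h1 : (2 * p) ^ K ≤ (2 * p) ^ k := pow_le_pow_right₀ hR.le hk
    rw [div_lt_iff₀ hδ] at hK
    have := hu k
    have := hB0 k
    simp only [hv]
    nlinarith
  have hkK : k < K := by
    by_contra! hk
    exact absurd (hK k hk) (not_le.2 hpos)
  obtain ⟨i, hi, himax⟩ := Finset.exists_max_image (Finset.range K) v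
    ⟨k, Finset.mem_range.2 hkK⟩
  have hD : 0 < v i := hpos.trans_le (himax k (Finset.mem_range.2 hkK))
  have hle : ∀ j, v j ≤ v i := fun j => by
    rcases lt_or_ge j K with hj | hj
    · exact himax j (Finset.mem_range.2 hj)
    · exact (hK j hj).trans hD.le
  classical
  -- At the leftmost maximum the left neighbour is strictly smaller and has weight p > 0, which
  -- contradicts `hstep`. At index 0 the value is at most -δ.
  have hex : ∃ j, v j = v i := ⟨i, rfl⟩
  have hj := Nat.find_spec hex
  have hmin : ∀ l, l < Nat.find hex → v l ≠ v i := fun l hl => Nat.find_min hex hl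
  rcases hj0 : Nat.find hex with _ | j
  · rw [hj0] at hj
    have h0 : v 0 = u 0 - 1 - δ := by simp [hv, hB]
    have := hu 0
    linarith
  · rw [hj0] at hj hmin
    have h1 : v j < v i := lt_of_le_of_ne (hle j) (hmin j (Nat.lt_succ_self j))
    have h2 := hstep j
    rw [hj] at h2
    have h3 : p * v j + (1 - p) * v (j + 2) < v i := by
      have := mul_lt_mul_of_pos_left h1 (by linarith : 0 < p)
      have := mul_le_mul_of_nonneg_left (hle (j + 2)) (by linarith : 0 ≤ 1 - p)
      linarith
    rcases le_or_gt 0 (p * v j + (1 - p) * v (j + 2)) with h4 | h4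
    · have := mul_le_of_le_one_left h4 (hc1 j)
      linarith
    · have := mul_nonpos_of_nonneg_of_nonpos (hc0 j) h4.le
      linarith

/-- The sites are numbered from the low frequency t a^N at k = 0 back to t at k = N, so the drift
towards low frequencies is a drift towards 0. -/
theorem le_prod_cos_of_subharmonic {p : ℝ} (hp : 1 / 2 < p) (hp1 : p ≤ 1) {ψ : ℝ → ℝ}
    (hψ : ∀ t, ψ t ≤ 1) {a : ℝ} (ha : a ≠ 0)
    (h : ∀ t, ψ t ≤ |Real.cos t| * (p * ψ (t * a) + (1 - p) * ψ (t * a⁻¹))) (t : ℝ) (N : ℕ) :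
    ψ t ≤ ∏ n ∈ Finset.range N, |Real.cos (t * a ^ n)| := by
  have key := le_prod_of_subharmonic_nat hp hp1 (u := fun k => ψ (t * a ^ N * a⁻¹ ^ k))
    (c := fun k => |Real.cos (t * a ^ N * a⁻¹ ^ (k + 1))|) (fun k => hψ _)
    (fun k => abs_nonneg _) (fun k => Real.abs_cos_le_one _) (fun k => by
      have := h (t * a ^ N * a⁻¹ ^ (k + 1))
      rwa [mul_assoc _ _ a, mul_assoc _ _ a⁻¹, ← pow_succ, pow_succ a⁻¹ k, mul_assoc _ a⁻¹ a,
        inv_mul_cancel₀ ha, mul_one, ← pow_succ] at this) N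
  have e : t * a ^ N * a⁻¹ ^ N = t := by
    rw [mul_assoc, ← mul_pow, mul_inv_cancel₀ ha, one_pow, mul_one]
  simp only [e] at key
  refine key.trans (le_of_eq ?_)
  rw [← Finset.prod_range_reflect]
  refine Finset.prod_congr rfl fun n hn => ?_
  obtain ⟨i, hi⟩ : ∃ i, N = n + i + 1 := ⟨N - n - 1, by have := Finset.mem_range.1 hn; omega⟩
  rw [show N - 1 - n + 1 = i + 1 by omega, hi, add_assoc, pow_add, ← mul_assoc,
    mul_assoc _ _ (a⁻¹ ^ _), ← mul_pow, mul_inv_cancel₀ ha, one_pow, mul_one]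

/-! ### A smooth density from decay of the characteristic function -/

section FourierDensity
open FourierTransform
open scoped ContDiff

/-- Parseval's formula for a finite measure and an integrable continuous function with integrable
Fourier transform. -/
theorem integral_eq_integral_charFun_smul_fourier {ν : Measure ℝ} [IsFiniteMeasure ν] {g : ℝ → ℂ}
    (hc : Continuous g) (hg : Integrable g) (hg' : Integrable (𝓕 g)) :
    ∫ x, g x ∂ν = ∫ ξ, charFun ν (2 * Real.pi * ξ) * 𝓕 g ξ := by
  have key := VectorFourier.integral_fourierIntegral_smul_eq_flip (μ := ν) (ν := volume)
    (L := -innerₗ ℝ) (f := fun _ => (1 : ℂ)) (g := 𝓕 g) Real.continuous_fourierChar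
    (by simp only [LinearMap.neg_apply, innerₗ_apply_apply]; fun_prop) (integrable_const _) hg'
  have e1 : ∀ ξ, VectorFourier.fourierIntegral Real.fourierChar ν (-innerₗ ℝ)
      (fun _ => (1 : ℂ)) ξ = charFun ν (2 * Real.pi * ξ) := by
    intro ξ
    rw [charFun_apply_real]
    simp only [VectorFourier.fourierIntegral, LinearMap.neg_apply, innerₗ_apply_apply, neg_neg,
      Circle.smul_def, Real.fourierChar_apply, smul_eq_mul, mul_one]
    congr 1
    ext x
    congr 1
    simp
    ring
  have e2 : ∀ x, VectorFourier.fourierIntegral Real.fourierChar volume (-innerₗ ℝ).flip (𝓕 g) x =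
      g x := by
    intro x
    have h := congrFun (hc.fourierInv_fourier_eq hg hg') x
    rw [← h, Real.fourierInv_eq]
    simp only [VectorFourier.fourierIntegral, LinearMap.flip_apply, LinearMap.neg_apply,
      innerₗ_apply_apply, neg_neg, real_inner_comm]
  simp only [e1, e2, smul_eq_mul, one_mul] at key
  exact key.symm

theorem integral_eq_integral_fourier_charFun_mul {ν : Measure ℝ} [IsFiniteMeasure ν]
    (hν : Integrable fun ξ => charFun ν (2 * Real.pi * ξ)) {g : ℝ → ℂ}
    (hc : Continuous g) (hg : Integrable g) (hg' : Integrable (𝓕 g)) :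
    ∫ x, g x ∂ν = ∫ x, 𝓕 (fun ξ => charFun ν (2 * Real.pi * ξ)) x * g x := by
  rw [integral_eq_integral_charFun_smul_fourier hc hg hg']
  have key := VectorFourier.integral_fourierIntegral_smul_eq_flip (μ := volume) (ν := volume)
    (L := innerₗ ℝ) (f := fun ξ => charFun ν (2 * Real.pi * ξ)) (g := g)
    Real.continuous_fourierChar (by simp only [innerₗ_apply_apply]; fun_prop) hν hg
  rw [flip_innerₗ] at key
  exact key.symm

theorem ContDiffBump.integrable_fourier {c : ℝ} (b : ContDiffBump c) :
    Integrable (𝓕 fun x => (b x : ℂ)) := by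
  have h1 : HasCompactSupport fun x => (b x : ℂ) := b.hasCompactSupport.comp_left Complex.ofReal_zero
  have h2 : ContDiff ℝ ∞ fun x => (b x : ℂ) := Complex.ofRealCLM.contDiff.comp b.contDiff
  have := (𝓕 (h1.toSchwartzMap h2)).integrable (μ := volume)
  rwa [SchwartzMap.fourier_coe] at this

/-- A smooth bump function that is `1` on all but a small part of a ball. -/
noncomputable def wideBump (c : ℝ) {r : ℝ} (hr : 0 < r) (n : ℕ) : ContDiffBump c where
  rIn := r * (1 - 1 / (n + 2))
  rOut := r
  rIn_pos := mul_pos hr (by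
    rw [sub_pos, div_lt_one (by positivity)]; have : (0 : ℝ) ≤ n := n.cast_nonneg; linarith)
  rIn_lt_rOut := mul_lt_of_lt_one_right hr (by
    have : (0 : ℝ) < 1 / (n + 2) := by positivity
    linarith)

theorem tendsto_wideBump (c : ℝ) {r : ℝ} (hr : 0 < r) (x : ℝ) :
    Tendsto (fun n => wideBump c hr n x) atTop
      (𝓝 ((Metric.ball c r).indicator (fun _ => (1 : ℝ)) x)) := by
  by_cases hx : x ∈ Metric.ball c r
  · rw [Set.indicator_of_mem hx]
    have h1 : Tendsto (fun n : ℕ => r * (1 - 1 / ((n : ℝ) + 2))) atTop (𝓝 (r * (1 - 0))) := by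
      refine ((tendsto_const_nhds (x := (1 : ℝ))).sub ?_).const_mul r
      exact tendsto_const_nhds.div_atTop
        (tendsto_atTop_add_const_right _ _ tendsto_natCast_atTop_atTop)
    rw [sub_zero, mul_one] at h1
    refine tendsto_const_nhds.congr' ?_
    filter_upwards [h1.eventually (lt_mem_nhds (Metric.mem_ball.1 hx))] with n hn
    exact ((wideBump c hr n).one_of_mem_closedBall (Metric.mem_closedBall.2 hn.le)).symm
  · rw [Set.indicator_of_notMem hx]
    refine tendsto_const_nhds.congr fun n => ?_
    exact ((wideBump c hr n).zero_of_le_dist (not_lt.1 hx)).symm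

theorem tendsto_integral_wideBump_mul {μ : Measure ℝ} {F : ℝ → ℂ} (hF : Integrable F μ)
    (c : ℝ) {r : ℝ} (hr : 0 < r) :
    Tendsto (fun n => ∫ x, F x * (wideBump c hr n x : ℂ) ∂μ) atTop
      (𝓝 (∫ x in Metric.ball c r, F x ∂μ)) := by
  rw [← integral_indicator Metric.isOpen_ball.measurableSet]
  refine tendsto_integral_of_dominated_convergence (fun x => ‖F x‖) (fun n => ?_) hF.norm
    (fun n => ?_) ?_
  · exact hF.aestronglyMeasurable.mul
      (Complex.continuous_ofReal.comp (wideBump c hr n).continuous).aestronglyMeasurable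
  · refine Eventually.of_forall fun x => ?_
    rw [norm_mul, Complex.norm_real, Real.norm_of_nonneg (wideBump c hr n).nonneg]
    exact mul_le_of_le_one_right (norm_nonneg _) (wideBump c hr n).le_one
  · refine Eventually.of_forall fun x => ?_
    have h := ((Complex.continuous_ofReal.tendsto _).comp (tendsto_wideBump c hr x)).const_mul (F x)
    have e : (Metric.ball c r).indicator F x =
        F x * (((Metric.ball c r).indicator (fun _ => (1 : ℝ)) x : ℝ) : ℂ) := by
      by_cases hx : x ∈ Metric.ball c r
      · rw [Set.indicator_of_mem hx, Set.indicator_of_mem hx, Complex.ofReal_one, mul_one]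
      · rw [Set.indicator_of_notMem hx, Set.indicator_of_notMem hx, Complex.ofReal_zero, mul_zero]
    rw [e]
    exact h

/-- Bumps increasing to fill the open ball are admissible test functions for the Parseval identity,
and dominated convergence applies to both sides. -/
theorem measureReal_ball_eq_integral {ν : Measure ℝ} [IsFiniteMeasure ν]
    (hν : Integrable fun ξ => charFun ν (2 * Real.pi * ξ))
    (hF : Continuous (𝓕 fun ξ => charFun ν (2 * Real.pi * ξ))) (c : ℝ) {r : ℝ} (hr : 0 < r) :
    ν.real (Metric.ball c r) =
      ∫ x in Metric.ball c r, (𝓕 (fun ξ => charFun ν (2 * Real.pi * ξ)) x).re := by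
  set F := 𝓕 fun ξ => charFun ν (2 * Real.pi * ξ) with hFdef
  have hball : IntegrableOn F (Metric.ball c r) :=
    (hF.continuousOn.integrableOn_compact (isCompact_closedBall c r)).mono_set
      Metric.ball_subset_closedBall
  have h1 := tendsto_integral_wideBump_mul (μ := ν) (F := fun _ => 1) (integrable_const _) c hr
  have h2 := tendsto_integral_wideBump_mul (μ := volume.restrict (Metric.ball c r)) hball c hr
  have h3 : ∀ n, ∫ x, 1 * (wideBump c hr n x : ℂ) ∂ν =
      ∫ x in Metric.ball c r, F x * (wideBump c hr n x : ℂ) := by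
    intro n
    simp only [one_mul]
    have hcont : Continuous fun x => (wideBump c hr n x : ℂ) :=
      Complex.continuous_ofReal.comp (wideBump c hr n).continuous
    have hsupp : HasCompactSupport fun x => (wideBump c hr n x : ℂ) :=
      (wideBump c hr n).hasCompactSupport.comp_left Complex.ofReal_zero
    rw [integral_eq_integral_fourier_charFun_mul hν hcont
      (hcont.integrable_of_hasCompactSupport hsupp) (wideBump c hr n).integrable_fourier]
    symm
    refine setIntegral_eq_integral_of_forall_compl_eq_zero fun x hx => ?_
    rw [(wideBump c hr n).zero_of_le_dist (not_lt.1 hx), Complex.ofReal_zero, mul_zero]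
  simp only [h3] at h1
  have h4 := tendsto_nhds_unique h1 h2
  rw [Measure.restrict_restrict Metric.isOpen_ball.measurableSet, Set.inter_self] at h4
  have h5 := congrArg Complex.re h4
  rw [← RCLike.re_eq_complex_re, ← integral_re hball] at h5
  simpa using h5

theorem nonneg_of_forall_setIntegral_ball_nonneg {f : ℝ → ℝ} (hf : Continuous f)
    (h : ∀ c r : ℝ, 0 < r → 0 ≤ ∫ x in Metric.ball c r, f x) (x : ℝ) : 0 ≤ f x := by
  by_contra! hx
  obtain ⟨r, hr, hball⟩ := Metric.eventually_nhds_iff_ball.1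
    (hf.continuousAt.eventually_lt_const (show f x < f x / 2 by linarith))
  have h1 : ∫ y in Metric.ball x r, f y ≤ ∫ y in Metric.ball x r, f x / 2 := by
    refine setIntegral_mono_on ?_ ?_ Metric.isOpen_ball.measurableSet fun y hy => (hball y hy).le
    · exact (hf.continuousOn.integrableOn_compact (isCompact_closedBall x r)).mono_set
        Metric.ball_subset_closedBall
    · exact integrableOn_const measure_ball_lt_top.ne
  rw [setIntegral_const, Real.volume_real_ball hr.le, smul_eq_mul] at h1
  have := h x r hr
  nlinarith

/-- A finite measure on the line whose characteristic function decays like `|t| ^ (-(k + 2))` has a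
density of class `C^k`. -/
theorem exists_contDiff_density {ν : Measure ℝ} [IsFiniteMeasure ν] {C : ℝ} {k : ℕ}
    (h : ∀ t : ℝ, ‖charFun ν t‖ ≤ C * (1 + |t|) ^ (-((k + 2 : ℕ) : ℝ))) :
    ∃ f : ℝ → ℝ, ContDiff ℝ k f ∧ (∀ t, 0 ≤ f t) ∧
      ν = volume.withDensity fun t => ENNReal.ofReal (f t) := by
  have hπ := Real.pi_gt_three
  have hC : 0 ≤ C := by
    have := (norm_nonneg _).trans (h 0)
    simpa using this
  set Ψ : ℝ → ℂ := fun ξ => charFun ν (2 * Real.pi * ξ) with hΨ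
  have hΨm : AEStronglyMeasurable Ψ volume :=
    (measurable_charFun.comp (measurable_const_mul _)).aestronglyMeasurable
  -- Of the k + 2 powers of decay, k pay for differentiating the transform and two for
  -- integrability.
  have hint : ∀ n : ℕ, n ≤ k → Integrable fun ξ => ‖ξ‖ ^ n * ‖Ψ ξ‖ := by
    intro n hn
    have hj : Integrable fun ξ : ℝ => (1 + ‖ξ‖) ^ (-2 : ℝ) :=
      integrable_one_add_norm (by simp)
    refine (hj.const_mul C).mono' ((by fun_prop : AEStronglyMeasurable (fun ξ : ℝ => ‖ξ‖ ^ n)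
      volume).mul hΨm.norm) (Eventually.of_forall fun ξ => ?_)
    rw [norm_mul, norm_pow, norm_norm, norm_norm]
    have h1 : (1 + |2 * Real.pi * ξ|) ^ (-((k + 2 : ℕ) : ℝ)) ≤ (1 + ‖ξ‖) ^ (-((k + 2 : ℕ) : ℝ)) := by
      refine Real.rpow_le_rpow_of_nonpos (by positivity) ?_ (neg_nonpos.2 (Nat.cast_nonneg _))
      rw [abs_mul, abs_of_pos (by positivity : 0 < 2 * Real.pi), Real.norm_eq_abs]
      nlinarith [abs_nonneg ξ]
    have h2 : ‖ξ‖ ^ n ≤ (1 + ‖ξ‖) ^ (k : ℝ) := by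
      rw [Real.rpow_natCast]
      calc ‖ξ‖ ^ n ≤ (1 + ‖ξ‖) ^ n := by gcongr; linarith
        _ ≤ (1 + ‖ξ‖) ^ k := pow_le_pow_right₀ (by linarith [norm_nonneg ξ]) hn
    calc ‖ξ‖ ^ n * ‖Ψ ξ‖ ≤ (1 + ‖ξ‖) ^ (k : ℝ) * (C * (1 + ‖ξ‖) ^ (-((k + 2 : ℕ) : ℝ))) := by
          gcongr
          exact (h _).trans (by gcongr)
      _ = C * (1 + ‖ξ‖) ^ (-2 : ℝ) := by
          rw [mul_left_comm, ← Real.rpow_add (by positivity)]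
          congr 2
          push_cast
          ring
  have hΨi : Integrable Ψ := by
    have := hint 0 (Nat.zero_le _)
    simp only [pow_zero, one_mul] at this
    exact (integrable_norm_iff hΨm).1 this
  have hFk : ContDiff ℝ k (𝓕 Ψ) := by
    refine Real.contDiff_fourier (N := k) fun n hn => hint n (by exact_mod_cast hn)
  have hfk : ContDiff ℝ k fun x => (𝓕 Ψ x).re := Complex.reCLM.contDiff.comp hFk
  have hball : ∀ c r : ℝ, 0 < r →
      ν.real (Metric.ball c r) = ∫ x in Metric.ball c r, (𝓕 Ψ x).re := fun c r hr =>
    measureReal_ball_eq_integral hΨi hFk.continuous c hr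
  have hnn := nonneg_of_forall_setIntegral_ball_nonneg hfk.continuous fun c r hr => by
    rw [← hball c r hr]; exact measureReal_nonneg
  refine ⟨fun x => (𝓕 Ψ x).re, hfk, hnn, ?_⟩
  refine Real.measure_ext_Ioo_rat fun a b => ?_
  rcases le_or_gt b a with hab | hab
  · rw [Set.Ioo_eq_empty (by exact_mod_cast not_lt.2 hab), measure_empty, measure_empty]
  have hab' : (a : ℝ) < b := by exact_mod_cast hab
  rw [Real.Ioo_eq_ball, withDensity_apply _ Metric.isOpen_ball.measurableSet,
    ← ofReal_integral_eq_lintegral_ofReal, ← hball _ _ (by linarith), ofReal_measureReal]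
  · exact (hfk.continuous.continuousOn.integrableOn_compact (isCompact_closedBall _ _)).mono_set
      Metric.ball_subset_closedBall
  · exact Eventually.of_forall hnn

end FourierDensity
-- Convergence of the walk and the first-step decomposition
open ProbabilityTheory

namespace Sol

/-- The sequence of increments `g, X 0, X 1, …`. -/
def cons (g : Sol) (X : ℕ → Sol) : ℕ → Sol
  | 0 => g
  | n + 1 => X n

theorem measurable_cons : Measurable fun q : Sol × (ℕ → Sol) => cons q.1 q.2 := by
  refine measurable_pi_iff.2 fun n => ?_
  cases n with
  | zero => exact measurable_fst
  | succ n => exact (measurable_pi_apply n).comp measurable_snd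

/-- It suffices to test cylinders. Enlarging the index set to an initial segment, with the whole
space at the new indices, lets coordinate 0 split off. -/
theorem map_cons_prod_infinitePi (μ : Measure Sol) [IsProbabilityMeasure μ] :
    (μ.prod (Measure.infinitePi fun _ : ℕ => μ)).map (fun q => cons q.1 q.2) =
      Measure.infinitePi fun _ : ℕ => μ := by
  refine Measure.eq_infinitePi _ fun s t ht => ?_
  classical
  obtain ⟨n, hn⟩ : ∃ n, s ⊆ Finset.range (n + 1) :=
    ⟨s.sup id, fun i hi => Finset.mem_range.2 (Nat.lt_succ_of_le (Finset.le_sup (f := id) hi))⟩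
  set t' : ℕ → Set Sol := fun i => if i ∈ s then t i else Set.univ with ht'
  have ht'm : ∀ i, MeasurableSet (t' i) := fun i => by
    simp only [ht']; split_ifs
    · exact ht i
    · exact .univ
  have e1 : Set.pi (s : Set ℕ) t = Set.pi (Finset.range (n + 1) : Set ℕ) t' := by
    ext X
    simp only [Set.mem_pi, Finset.mem_coe, ht']
    constructor
    · intro h i _
      split_ifs with hi
      · exact h i hi
      · trivial
    · intro h i hi
      have := h i (hn hi)
      rwa [if_pos hi] at this
  have e2 : ∏ i ∈ s, μ (t i) = ∏ i ∈ Finset.range (n + 1), μ (t' i) := by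
    rw [← Finset.prod_subset hn]
    · exact Finset.prod_congr rfl fun i hi => by simp only [ht', if_pos hi]
    · intro i _ hi
      simp only [ht', if_neg hi, measure_univ]
  have e3 : (fun q : Sol × (ℕ → Sol) => cons q.1 q.2) ⁻¹'
      Set.pi (Finset.range (n + 1) : Set ℕ) t' =
      t' 0 ×ˢ Set.pi (Finset.range n : Set ℕ) fun i => t' (i + 1) := by
    ext ⟨g, X⟩
    simp only [Set.mem_preimage, Set.mem_pi, Finset.coe_range, Set.mem_Iio, Set.mem_prod]
    constructor
    · exact fun h => ⟨h 0 (Nat.succ_pos n), fun i hi => h (i + 1) (Nat.succ_lt_succ hi)⟩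
    · rintro ⟨h0, h⟩ (_ | i) hi
      · exact h0
      · exact h i (Nat.lt_of_succ_lt_succ hi)
  rw [e1, e2, Measure.map_apply measurable_cons
    (MeasurableSet.pi (Finset.countable_toSet _) fun i _ => ht'm i), e3, Measure.prod_prod,
    Measure.infinitePi_pi _ fun i _ => ht'm (i + 1), Finset.prod_range_succ', mul_comm]

theorem walk_cons (g : Sol) (X : ℕ → Sol) (n : ℕ) : walk (cons g X) (n + 1) = g * walk X n := by
  induction n with
  | zero => simp [walk, cons]
  | succ n ih =>
    rw [walk, ih, walk, mul_assoc]
    rfl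

theorem walk_z (X : ℕ → Sol) (n : ℕ) : (walk X n).z = ∑ j ∈ Finset.range n, (X j).z := by
  induction n with
  | zero => simp [walk]
  | succ n ih => rw [walk, mul_z, ih, Finset.sum_range_succ]

theorem walk_x (X : ℕ → Sol) (n : ℕ) :
    (walk X n).x = ∑ j ∈ Finset.range n, Real.exp (-(walk X j).z) * (X j).x := by
  induction n with
  | zero => simp [walk]
  | succ n ih => rw [walk, mul_x, ih, Finset.sum_range_succ]

theorem boundaryPoint_of_tendsto {W : ℕ → Sol} {l : ℝ}
    (h : Tendsto (fun n => (W n).x) atTop (𝓝 l)) : boundaryPoint W = l :=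
  h.limUnder_eq

/-- Left translation by g acts on the boundary by an affine map; this is the source of the
functional equation. -/
theorem boundaryPoint_walk_cons (g : Sol) {X : ℕ → Sol} {l : ℝ}
    (h : Tendsto (fun n => (walk X n).x) atTop (𝓝 l)) :
    boundaryPoint (walk (cons g X)) = g.x + Real.exp (-g.z) * boundaryPoint (walk X) := by
  rw [boundaryPoint_of_tendsto h]
  refine boundaryPoint_of_tendsto ((tendsto_add_atTop_iff_nat 1).1 ?_)
  simp only [walk_cons, mul_x]
  exact (h.const_mul _).const_add _

/-- If the vertical drift is positive and the horizontal increments are bounded, then the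
horizontal component of the walk converges. -/
theorem exists_tendsto_walk_x {X : ℕ → Sol} {v : ℝ} (hv : 0 < v)
    (hz : Tendsto (fun n : ℕ => (∑ i ∈ Finset.range n, (X i).z) / n) atTop (𝓝 v))
    (hx : ∀ n, |(X n).x| ≤ 1) : ∃ l, Tendsto (fun n => (walk X n).x) atTop (𝓝 l) := by
  have hs : Summable fun j => Real.exp (-(walk X j).z) * (X j).x := by
    refine Summable.of_norm_bounded_eventually_nat
      (g := fun n : ℕ => Real.exp (-(v / 2)) ^ n)
      (summable_geometric_of_lt_one (Real.exp_pos _).le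
        (Real.exp_lt_one_iff.2 (by linarith))) ?_
    filter_upwards [hz.eventually (lt_mem_nhds (half_lt_self hv)), eventually_gt_atTop 0]
      with n hn hn0
    rw [lt_div_iff₀ (by exact_mod_cast hn0), ← walk_z] at hn
    rw [norm_mul, Real.norm_of_nonneg (Real.exp_pos _).le, Real.norm_eq_abs]
    refine (mul_le_of_le_one_right (Real.exp_pos _).le (hx n)).trans ?_
    rw [← Real.exp_nat_mul]
    exact Real.exp_le_exp.2 (by linarith)
  refine ⟨_, hs.hasSum.tendsto_sum_nat.congr fun n => (walk_x X n).symm⟩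

theorem ae_exists_tendsto_walk_x (μ : Measure Sol) [IsProbabilityMeasure μ]
    (hz : Integrable Sol.z μ) (hv : 0 < ∫ g, g.z ∂μ) (hx : ∀ᵐ g ∂μ, |g.x| ≤ 1) :
    ∀ᵐ X ∂(Measure.infinitePi fun _ : ℕ => μ),
      ∃ l, Tendsto (fun n => (walk X n).x) atTop (𝓝 l) := by
  set P := Measure.infinitePi fun _ : ℕ => μ with hP
  have hmp : ∀ n, MeasurePreserving (Function.eval n) P μ := fun n =>
    measurePreserving_eval_infinitePi (fun _ : ℕ => μ) n
  have hx' : ∀ᵐ X ∂P, ∀ n : ℕ, |(X n).x| ≤ 1 :=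
    ae_all_iff.2 fun n => (hmp n).quasiMeasurePreserving.ae hx
  have hind : iIndepFun (fun (i : ℕ) (X : ℕ → Sol) => (X i).z) P :=
    iIndepFun_infinitePi (P := fun _ : ℕ => μ) (X := fun _ : ℕ => Sol.z) fun _ => measurable_z
  have hslln := strong_law_ae_real (μ := P) (fun (i : ℕ) (X : ℕ → Sol) => (X i).z)
    ((hmp 0).integrable_comp_of_integrable hz) (fun i j hij => hind.indepFun hij)
    (fun i => ⟨(measurable_z.comp (measurable_pi_apply i)).aemeasurable,
      (measurable_z.comp (measurable_pi_apply 0)).aemeasurable, by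
        have h : ∀ i, P.map (fun X : ℕ → Sol => (X i).z) = μ.map Sol.z := fun i => by
          rw [← (hmp i).map_eq, Measure.map_map measurable_z (measurable_pi_apply i)]
          rfl
        rw [h, h]⟩)
  have hmean : ∫ X, (X 0).z ∂P = ∫ g, g.z ∂μ := by
    rw [← (hmp 0).map_eq, integral_map (measurable_pi_apply 0).aemeasurable
      measurable_z.aestronglyMeasurable]
  filter_upwards [hslln, hx'] with X h1 h2
  rw [hmean] at h1
  exact exists_tendsto_walk_x hv h1 h2

theorem ae_tendsto_boundaryPoint (μ : Measure Sol) [IsProbabilityMeasure μ]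
    (h : ∀ᵐ X ∂(Measure.infinitePi fun _ : ℕ => μ),
      ∃ l, Tendsto (fun n => (walk X n).x) atTop (𝓝 l)) :
    ∀ᵐ W ∂(pathLaw μ), Tendsto (fun n => (W n).x) atTop (𝓝 (boundaryPoint W)) := by
  have hm : MeasurableSet {W : ℕ → Sol | ∃ l, Tendsto (fun n => (W n).x) atTop (𝓝 l)} :=
    MeasureTheory.measurableSet_exists_tendsto fun n => measurable_x.comp (measurable_pi_apply n)
  have h' : ∀ᵐ W ∂(pathLaw μ), ∃ l, Tendsto (fun n => (W n).x) atTop (𝓝 l) :=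
    (ae_map_iff measurable_walk.aemeasurable hm).2 h
  filter_upwards [h'] with W hW
  exact tendsto_nhds_limUnder hW

theorem aemeasurable_boundaryPoint {μ : Measure Sol} [IsProbabilityMeasure μ]
    (h : ∀ᵐ W ∂(pathLaw μ), Tendsto (fun n => (W n).x) atTop (𝓝 (boundaryPoint W))) :
    AEMeasurable boundaryPoint (pathLaw μ) :=
  aemeasurable_of_tendsto_metrizable_ae atTop
    (fun n => (measurable_x.comp (measurable_pi_apply n)).aemeasurable) h

/-- The functional equation of the characteristic function of the harmonic measure. -/
theorem charFun_harmonicMeasure (μ : Measure Sol) [IsProbabilityMeasure μ]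
    (h : ∀ᵐ X ∂(Measure.infinitePi fun _ : ℕ => μ),
      ∃ l, Tendsto (fun n => (walk X n).x) atTop (𝓝 l)) (t : ℝ) :
    charFun (harmonicMeasure μ) t =
      ∫ g, Complex.exp (t * g.x * Complex.I) *
        charFun (harmonicMeasure μ) (t * Real.exp (-g.z)) ∂μ := by
  set P := Measure.infinitePi fun _ : ℕ => μ with hP
  have hbm := aemeasurable_boundaryPoint (ae_tendsto_boundaryPoint μ h)
  have hξ : AEMeasurable (fun X => boundaryPoint (walk X)) P :=
    hbm.comp_measurable measurable_walk
  have hlaw : harmonicMeasure μ = P.map fun X => boundaryPoint (walk X) :=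
    AEMeasurable.map_map_of_aemeasurable hbm measurable_walk.aemeasurable
  have hφ : ∀ s, charFun (harmonicMeasure μ) s =
      ∫ X, Complex.exp (s * boundaryPoint (walk X) * Complex.I) ∂P := fun s => by
    rw [charFun_apply_real, hlaw, integral_map hξ]
    exact (by fun_prop : Continuous fun x : ℝ =>
      Complex.exp (s * x * Complex.I)).aestronglyMeasurable
  have hmeas : AEMeasurable (fun q : Sol × (ℕ → Sol) => boundaryPoint (walk q.2)) (μ.prod P) :=
    hξ.comp_quasiMeasurePreserving Measure.quasiMeasurePreserving_snd
  have hconv : ∀ᵐ q ∂(μ.prod P), ∃ l, Tendsto (fun n => (walk q.2 n).x) atTop (𝓝 l) :=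
    Measure.quasiMeasurePreserving_snd.ae h
  have hξ' : AEMeasurable (fun X => boundaryPoint (walk X))
      ((μ.prod P).map fun q => cons q.1 q.2) := by
    rw [map_cons_prod_infinitePi]; exact hξ
  have hexp : Measurable fun x : ℝ => Complex.exp (t * x * Complex.I) := by fun_prop
  have hmx : Measurable fun q : Sol × (ℕ → Sol) => q.1.x := measurable_x.comp measurable_fst
  have hmz : Measurable fun q : Sol × (ℕ → Sol) => q.1.z := measurable_z.comp measurable_fst
  calc charFun (harmonicMeasure μ) t
      = ∫ X, Complex.exp (t * boundaryPoint (walk X) * Complex.I)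
          ∂((μ.prod P).map fun q => cons q.1 q.2) := by
        rw [hφ, map_cons_prod_infinitePi]
    _ = ∫ q, Complex.exp (t * boundaryPoint (walk (cons q.1 q.2)) * Complex.I) ∂(μ.prod P) :=
        integral_map measurable_cons.aemeasurable
          (hexp.comp_aemeasurable hξ').aestronglyMeasurable
    _ = ∫ q, Complex.exp (t * q.1.x * Complex.I) *
          Complex.exp ((t * Real.exp (-q.1.z) : ℝ) * boundaryPoint (walk q.2) * Complex.I)
          ∂(μ.prod P) := by
        refine integral_congr_ae ?_
        filter_upwards [hconv] with q hq
        obtain ⟨l, hl⟩ := hq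
        rw [boundaryPoint_walk_cons q.1 hl, ← Complex.exp_add]
        congr 1
        push_cast
        ring
    _ = ∫ g, ∫ X, Complex.exp (t * g.x * Complex.I) *
          Complex.exp ((t * Real.exp (-g.z) : ℝ) * boundaryPoint (walk X) * Complex.I) ∂P ∂μ := by
        refine integral_prod _ ?_
        have hm : AEMeasurable (fun q : Sol × (ℕ → Sol) => Complex.exp (t * q.1.x * Complex.I) *
            Complex.exp ((t * Real.exp (-q.1.z) : ℝ) * boundaryPoint (walk q.2) * Complex.I))
            (μ.prod P) := by
          refine (hexp.comp hmx).aemeasurable.mul ?_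
          refine Complex.measurable_exp.comp_aemeasurable (AEMeasurable.mul_const ?_ _)
          refine AEMeasurable.mul ?_ (Complex.measurable_ofReal.comp_aemeasurable hmeas)
          exact (Complex.measurable_ofReal.comp
            ((Real.measurable_exp.comp hmz.neg).const_mul t)).aemeasurable
        refine Integrable.of_bound hm.aestronglyMeasurable 1 (Eventually.of_forall fun q => ?_)
        rw [norm_mul, ← Complex.ofReal_mul, ← Complex.ofReal_mul, Complex.norm_exp_ofReal_mul_I,
          Complex.norm_exp_ofReal_mul_I, one_mul]
    _ = _ := by
        refine integral_congr_ae (Eventually.of_forall fun g => ?_)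
        simp only
        rw [integral_const_mul, ← hφ]

end Sol
-- The functional equation for the given increments
open ProbabilityTheory

namespace Sol

theorem charFun_coin (t : ℝ) :
    charFun (ENNReal.ofReal (1 / 2) • Measure.dirac (1 : ℝ)
      + ENNReal.ofReal (1 / 2) • Measure.dirac (-1)) t = Real.cos t := by
  have hi : ∀ a : ℝ, Integrable (fun x : ℝ => Complex.exp (t * x * Complex.I))
      (ENNReal.ofReal (1 / 2) • Measure.dirac a) := fun a =>
    (integrable_dirac (by simp)).smul_measure ENNReal.ofReal_ne_top
  rw [charFun_apply_real, integral_add_measure (hi 1) (hi (-1)), integral_smul_measure,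
    integral_smul_measure, integral_dirac, integral_dirac, ENNReal.toReal_ofReal (by norm_num),
    Complex.ofReal_cos, Complex.cos]
  simp only [Complex.real_smul]
  push_cast
  ring_nf

theorem charFun_harmonicMeasure_eq {γ p : ℝ} (hp : 0 ≤ p) (hp1 : p ≤ 1)
    {μ : Measure Sol} [IsProbabilityMeasure μ]
    (hconv : ∀ᵐ X ∂(Measure.infinitePi fun _ : ℕ => μ),
      ∃ l, Tendsto (fun n => (walk X n).x) atTop (𝓝 l))
    (hprod : μ.map (fun g => (g.z, g.x)) = (μ.map Sol.z).prod (μ.map Sol.x))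
    (hz : μ.map Sol.z =
      ENNReal.ofReal p • Measure.dirac γ + ENNReal.ofReal (1 - p) • Measure.dirac (-γ))
    (hx : μ.map Sol.x = ENNReal.ofReal (1 / 2) • Measure.dirac 1
      + ENNReal.ofReal (1 / 2) • Measure.dirac (-1)) (t : ℝ) :
    charFun (harmonicMeasure μ) t = Real.cos t *
      (p * charFun (harmonicMeasure μ) (t * Real.exp (-γ)) +
        (1 - p) * charFun (harmonicMeasure μ) (t * Real.exp γ)) := by
  have hμz : IsProbabilityMeasure (μ.map Sol.z) :=
    Measure.isProbabilityMeasure_map measurable_z.aemeasurable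
  have hμx : IsProbabilityMeasure (μ.map Sol.x) :=
    Measure.isProbabilityMeasure_map measurable_x.aemeasurable
  set φ := charFun (harmonicMeasure μ) with hφ
  have hbm := aemeasurable_boundaryPoint (ae_tendsto_boundaryPoint μ hconv)
  have hν : IsProbabilityMeasure (harmonicMeasure μ) := Measure.isProbabilityMeasure_map hbm
  have hφm : Measurable φ := measurable_charFun
  have hm : Measurable fun z : ℝ => φ (t * Real.exp (-z)) := by fun_prop
  have hi : ∀ a : ℝ, Integrable (fun z : ℝ => φ (t * Real.exp (-z))) (Measure.dirac a) :=
    fun a => integrable_dirac (by simp)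
  have e1 : ∫ z, φ (t * Real.exp (-z)) ∂(μ.map Sol.z) =
      p * φ (t * Real.exp (-γ)) + (1 - p) * φ (t * Real.exp γ) := by
    rw [hz, integral_add_measure ((hi γ).smul_measure ENNReal.ofReal_ne_top)
      ((hi (-γ)).smul_measure ENNReal.ofReal_ne_top), integral_smul_measure, integral_smul_measure,
      integral_dirac, integral_dirac, ENNReal.toReal_ofReal hp,
      ENNReal.toReal_ofReal (by linarith), neg_neg]
    simp only [Complex.real_smul]
    push_cast
    rfl
  have e2 : ∫ x, Complex.exp (t * x * Complex.I) ∂(μ.map Sol.x) = Real.cos t := by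
    rw [← charFun_apply_real, hx, charFun_coin]
  -- The product form of the law of (z, x) factors the first-step integral into the coin's cos t and
  -- the average of φ over vertical jumps.
  rw [hφ, charFun_harmonicMeasure μ hconv t, ← hφ, ← e1, ← e2, mul_comm, ← integral_prod_mul, ← hprod,
    integral_map (measurable_z.prodMk measurable_x).aemeasurable]
  · exact integral_congr_ae (Eventually.of_forall fun g => mul_comm _ _)
  · exact ((hm.comp measurable_fst).mul (by fun_prop)).aestronglyMeasurable

theorem norm_charFun_harmonicMeasure_le {γ p : ℝ} (hp : 1 / 2 < p) (hp1 : p ≤ 1)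
    {ν : Measure ℝ} [IsProbabilityMeasure ν]
    (h : ∀ t, charFun ν t = Real.cos t *
      (p * charFun ν (t * Real.exp (-γ)) + (1 - p) * charFun ν (t * Real.exp γ)))
    (t : ℝ) (N : ℕ) :
    ‖charFun ν t‖ ≤ ∏ n ∈ Finset.range N, |Real.cos (t * Real.exp (-γ) ^ n)| := by
  refine le_prod_cos_of_subharmonic hp hp1 (ψ := fun t => ‖charFun ν t‖)
    (fun t => norm_charFun_le_one t) (Real.exp_pos _).ne' (fun t => ?_) t N
  rw [h t, norm_mul, Complex.norm_real, Real.norm_eq_abs, ← Real.exp_neg, neg_neg]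
  refine mul_le_mul_of_nonneg_left ((norm_add_le _ _).trans (le_of_eq ?_)) (abs_nonneg _)
  rw [norm_mul, norm_mul, Complex.norm_real, Real.norm_of_nonneg (by linarith : 0 ≤ p),
    ← Complex.ofReal_one, ← Complex.ofReal_sub, Complex.norm_real,
    Real.norm_of_nonneg (by linarith : 0 ≤ 1 - p)]

theorem ae_exists_tendsto_of_map {γ p : ℝ} (hγ : 0 < γ) (hp : 1 / 2 < p) (hp1 : p ≤ 1)
    {μ : Measure Sol} [IsProbabilityMeasure μ]
    (hz : μ.map Sol.z =
      ENNReal.ofReal p • Measure.dirac γ + ENNReal.ofReal (1 - p) • Measure.dirac (-γ))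
    (hx : μ.map Sol.x = ENNReal.ofReal (1 / 2) • Measure.dirac 1
      + ENNReal.ofReal (1 / 2) • Measure.dirac (-1)) :
    ∀ᵐ X ∂(Measure.infinitePi fun _ : ℕ => μ),
      ∃ l, Tendsto (fun n => (walk X n).x) atTop (𝓝 l) := by
  have hi : ∀ a b : ℝ, Integrable id (ENNReal.ofReal b • Measure.dirac a) := fun a b =>
    (integrable_dirac (by simp)).smul_measure ENNReal.ofReal_ne_top
  have hzi : Integrable id (μ.map Sol.z) := by
    rw [hz]; exact (hi _ _).add_measure (hi _ _)
  refine ae_exists_tendsto_walk_x μ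
    ((integrable_map_measure aestronglyMeasurable_id measurable_z.aemeasurable).1 hzi) ?_ ?_
  · have e : ∫ g, g.z ∂μ = ∫ z, id z ∂(μ.map Sol.z) :=
      (integral_map measurable_z.aemeasurable aestronglyMeasurable_id).symm
    rw [e, hz, integral_add_measure (hi _ _) (hi _ _), integral_smul_measure,
      integral_smul_measure, integral_dirac, integral_dirac, ENNReal.toReal_ofReal (by linarith),
      ENNReal.toReal_ofReal (by linarith)]
    simp only [id, smul_eq_mul]
    -- The drift is (2p - 1)γ.
    nlinarith
  · have hm : MeasurableSet {x : ℝ | |x| ≤ 1} := measurableSet_le (by fun_prop) measurable_const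
    refine (ae_map_iff measurable_x.aemeasurable hm).1 ?_
    rw [hx, ae_add_measure_iff]
    constructor <;>
    · refine Measure.ae_smul_measure ?_ _
      rw [ae_dirac_iff hm]
      norm_num

end Sol

theorem mainTheorem6 (k : ℕ) :
    ∃ γk : ℝ, 0 < γk ∧
      ∀ᵐ γ ∂(volume.restrict (Set.Ioo 0 γk)),
        ∀ (p : ℝ), 1 / 2 < p → p ≤ 1 →
        ∀ (μ : Measure Sol) [IsProbabilityMeasure μ],
          Sol.HasFiniteFirstMoment μ →
          μ.map (fun g => (g.z, g.x)) = (μ.map Sol.z).prod (μ.map Sol.x) →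
          μ.map Sol.z =
            ENNReal.ofReal p • Measure.dirac γ + ENNReal.ofReal (1 - p) • Measure.dirac (-γ) →
          μ.map Sol.x =
            ENNReal.ofReal (1 / 2) • Measure.dirac 1
              + ENNReal.ofReal (1 / 2) • Measure.dirac (-1) →
          (∀ᵐ W ∂(Sol.pathLaw μ),
            Tendsto (fun n => (W n).x) atTop (𝓝 (Sol.boundaryPoint W))) ∧
          ∃ f : ℝ → ℝ, ContDiff ℝ k f ∧ (∀ t, 0 ≤ f t) ∧
            Sol.harmonicMeasure μ = volume.withDensity (fun t => ENNReal.ofReal (f t)) := by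
  obtain ⟨γk, hγk, hae⟩ := ErdosKahane.ae_small_exists_prod_cos_le (k + 2)
  refine ⟨γk, hγk, ?_⟩
  rw [ae_restrict_iff' measurableSet_Ioo]
  filter_upwards [hae] with γ hγ hmem p hp hp1 μ _ _ hprod hz hx
  obtain ⟨C, hC⟩ := hγ hmem.1 hmem.2
  have hconv := Sol.ae_exists_tendsto_of_map hmem.1 hp hp1 hz hx
  have hbp := Sol.ae_tendsto_boundaryPoint μ hconv
  refine ⟨hbp, ?_⟩
  have : IsProbabilityMeasure (Sol.harmonicMeasure μ) :=
    Measure.isProbabilityMeasure_map (Sol.aemeasurable_boundaryPoint hbp)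
  refine exists_contDiff_density (C := C) fun t => ?_
  have key : ∀ t : ℝ, 0 ≤ t → ‖charFun (Sol.harmonicMeasure μ) t‖ ≤
      C * (1 + t) ^ (-((k + 2 : ℕ) : ℝ)) := fun t ht => by
    obtain ⟨N, hN⟩ := hC t ht
    exact (Sol.norm_charFun_harmonicMeasure_le hp hp1
      (Sol.charFun_harmonicMeasure_eq (by linarith) hp1 hconv hprod hz hx) t N).trans hN
  -- Negative frequencies reduce to positive ones, since conjugation preserves the norm.
  rcases le_total 0 t with ht | ht
  · rw [abs_of_nonneg ht]
    exact key t ht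
  · rw [abs_of_nonpos ht]
    have := key (-t) (by linarith)
    rwa [charFun_neg, RCLike.norm_conj] at this
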